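/- Let $l_1,l_2$ be real numbers with $0<l_2\le l_1$. For a nondegenerate triangle $ABC$ in the Euclidean plane let $a=BC$, $b=CA$, $c=AB$, and let $l_a$, $l_b$ be the lengths of the (internal) bisectors of the angles at $A$ and $B$, measured from the vertex to the opposite side. Put $$B_{\max}=2\arctan\frac{l_2}{l_1},\qquad A_{\max}=\pi-B_{\max},$$ $$c^{*}=\tfrac12\left(l_1+l_2+\sqrt{l_1^2+l_2^2-l_1l_2}\right),\qquad c^{**}=\tfrac12\sqrt{l_1^2+l_2^2},$$ $$a^{*}=\frac{c^{*}}{2c^{*}/l_1-1},\qquad b^{*}=\frac{c^{*}}{2c^{*}/l_2-1}.$$ Then, among the triangles with $l_a=l_2$ and $l_b=l_1$, the following hold, where uniqueness is up to congruence respecting the labels of the vertices. 1. For a real number $\alpha$, if $0<\alpha<A_{\max}$ there is a unique such triangle with $\angle A=\alpha$; otherwise there is none. 2. For a real number $\beta$, if $0<\beta<B_{\max}$ there is a unique such triangle with $\angle B=\beta$; otherwise there is none. 3. For a real number $\gamma$, if $0<\gamma<\pi$ there is a unique such triangle with $\angle C=\gamma$; otherwise there is none. 4. For a real number $x$, if $x>a^{*}$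 there is a unique such triangle with $a=x$; otherwise there is none. 5. For a real number $x$, if $x>b^{*}$ there is a unique such triangle with $b=x$; otherwise there is none. 6. For a real number $x$, if $c^{**}<x<c^{*}$ there is a unique such triangle with $c=x$; otherwise there is none. -/

import Mathlib

open EuclideanGeometry

noncomputable section

namespace TwoBisectors

/-- Nondegenerate triangles `ABC` in the Euclidean plane, with labelled vertices
`A = T.points 0`, `B = T.points 1`, `C = T.points 2`. -/
abbrev Tri : Type := Affine.Triangle ℝ (EuclideanSpace ℝ (Fin 2))

/-- The angle at the vertex `A`. -/
def angleA (T : Tri) : ℝ := ∠ (T.points 1) (T.points 0) (T.points 2)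

/-- The angle at the vertex `B`. -/
def angleB (T : Tri) : ℝ := ∠ (T.points 0) (T.points 1) (T.points 2)

/-- The angle at the vertex `C`. -/
def angleC (T : Tri) : ℝ := ∠ (T.points 0) (T.points 2) (T.points 1)

/-- The side `a = BC`. -/
def sideA (T : Tri) : ℝ := dist (T.points 1) (T.points 2)

/-- The side `b = CA`. -/
def sideB (T : Tri) : ℝ := dist (T.points 2) (T.points 0)

/-- The side `c = AB`. -/
def sideC (T : Tri) : ℝ := dist (T.points 0) (T.points 1)

/-- The bisector of the angle at `X` in the triangle `XYZ`, that is the segment `XL` with `L` on the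
side `YZ` and `∠ YXL = ∠ LXZ`, has length `l`. -/
def BisectorHasLength (X Y Z : EuclideanSpace ℝ (Fin 2)) (l : ℝ) : Prop :=
  ∃ L : EuclideanSpace ℝ (Fin 2), Sbtw ℝ Y L Z ∧ ∠ Y X L = ∠ L X Z ∧ dist X L = l

/-- The bisectors of the angles at `A` and at `B` have lengths `la` and `lb`. -/
def HasBisectors (T : Tri) (la lb : ℝ) : Prop :=
  BisectorHasLength (T.points 0) (T.points 1) (T.points 2) la ∧
    BisectorHasLength (T.points 1) (T.points 0) (T.points 2) lb

/-- If `x ∈ S` then there is a triangle with bisectors `la`, `lb` at `A`, `B` whose third element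
`elt` has the value `x`, and it is unique up to congruence (respecting the labels of the vertices);
if `x ∉ S` then there is no such triangle. -/
def UniqueExactlyOn (la lb : ℝ) (elt : Tri → ℝ) (S : Set ℝ) : Prop :=
  ∀ x : ℝ,
    (x ∈ S → ∃ T : Tri, (HasBisectors T la lb ∧ elt T = x) ∧
      ∀ T' : Tri, HasBisectors T' la lb ∧ elt T' = x → Congruent T'.points T.points) ∧
    (x ∉ S → ¬ ∃ T : Tri, HasBisectors T la lb ∧ elt T = x)

/-- The limiting value of the angle `B`. -/
def maxB (l₁ l₂ : ℝ) : ℝ := 2 * Real.arctan (l₂ / l₁)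

/-- The limiting value of the angle `A`. -/
def maxA (l₁ l₂ : ℝ) : ℝ := Real.pi - maxB l₁ l₂

/-- `c^*`, the upper limiting value of the side `c`. -/
def cStar (l₁ l₂ : ℝ) : ℝ := (l₁ + l₂ + Real.sqrt (l₁ ^ 2 + l₂ ^ 2 - l₁ * l₂)) / 2

/-- `a^*`, the lower limiting value of the side `a`. -/
def aStar (l₁ l₂ : ℝ) : ℝ := cStar l₁ l₂ / (cStar l₁ l₂ * (2 / l₁) - 1)

/-- `b^*`, the lower limiting value of the side `b`. -/
def bStar (l₁ l₂ : ℝ) : ℝ := cStar l₁ l₂ / (cStar l₁ l₂ * (2 / l₂) - 1)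

/-- `c^{**}`, the lower limiting value of the side `c`. -/
def cStarStar (l₁ l₂ : ℝ) : ℝ := Real.sqrt (l₁ ^ 2 + l₂ ^ 2) / 2

end TwoBisectors

end

/-!
The bisector at `A` cuts off a triangle at `B`, and the bisector at `B` one at `A`. With the
half-angles `α` and `β` at `A` and `B`, the law of sines in these two triangles says
`c * sin (2 * α) = l₁ * sin (2 * α + β)` and `c * sin (2 * β) = l₂ * sin (2 * β + α)`.

Eliminating `c` prescribes the value `l₁ / l₂` of a function which increases in `α` and decreases in
`β`. Hence the pairs of half-angles form a curve on which both increase; parametrized by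
`s = α + β`, it leads from `(0, 0)` at `s = 0` to `(arctan (l₁ / l₂), arctan (l₂ / l₁))` at
`s = π / 2`. Moreover, `c` is the larger root of a quadratic polynomial which makes sense at `s = 0`
too and shows that `c` decreases in `s`, and `1 / a = 2 * cos β / l₁ - 1 / c` and
`1 / b = 2 * cos α / l₂ - 1 / c`. So each third element, or the inverse of it, is a continuous and
strictly monotone function of `s` in `[0, π / 2]`, and its values at the end points are the limits.
-/

namespace TwoBisectors

open Set

section Bisector

variable {V P : Type*} [NormedAddCommGroup V] [InnerProductSpace ℝ V] [MetricSpace P]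
  [NormedAddTorsor V P]

theorem angle_add_eq_angle_add_of_norm_eq {x y : V} (h : ‖x‖ = ‖y‖) :
    InnerProductGeometry.angle x (x + y) = InnerProductGeometry.angle (x + y) y := by
  have := InnerProductGeometry.angle_sub_eq_angle_sub_rev_of_norm_eq (x := x) (y := -y)
    (h.trans (norm_neg y).symm)
  rwa [sub_neg_eq_add, ← neg_add', InnerProductGeometry.angle_neg_neg,
    InnerProductGeometry.angle_comm y, add_comm y] at this

theorem exists_sbtw_angle_eq_angle {X Y Z : P} (h : ¬Collinear ℝ {X, Y, Z}) :
    ∃ L, Sbtw ℝ Y L Z ∧ ∠ Y X L = ∠ L X Z := by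
  set y := Y -ᵥ X with hy
  set z := Z -ᵥ X with hz
  have hy0 : 0 < ‖y‖ := norm_pos_iff.2 (vsub_ne_zero.2 (ne₁₂_of_not_collinear h).symm)
  have hz0 : 0 < ‖z‖ := norm_pos_iff.2 (vsub_ne_zero.2 (ne₁₃_of_not_collinear h).symm)
  set t := ‖y‖ / (‖y‖ + ‖z‖) with ht
  have hL : AffineMap.lineMap Y Z t -ᵥ X = (‖y‖ + ‖z‖)⁻¹ • (‖z‖ • y + ‖y‖ • z) := by
    rw [AffineMap.lineMap_apply, vadd_vsub_assoc, ← vsub_sub_vsub_cancel_right Z Y X, ← hy, ← hz,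
      ht]
    match_scalars <;> field_simp
    ring
  refine ⟨AffineMap.lineMap Y Z t, sbtw_lineMap_iff.2 ⟨ne₂₃_of_not_collinear h, by positivity, ?_⟩,
    ?_⟩
  · rw [ht, div_lt_one (by positivity)]
    linarith
  · have hnorm : ‖‖z‖ • y‖ = ‖‖y‖ • z‖ := by
      rw [norm_smul, norm_smul, norm_norm, norm_norm, mul_comm]
    have key := angle_add_eq_angle_add_of_norm_eq hnorm
    rw [InnerProductGeometry.angle_smul_left_of_pos _ _ hz0,
      InnerProductGeometry.angle_smul_right_of_pos _ _ hy0] at key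
    have hpos : 0 < (‖y‖ + ‖z‖)⁻¹ := by positivity
    rw [EuclideanGeometry.angle, EuclideanGeometry.angle, hL,
      InnerProductGeometry.angle_smul_right_of_pos _ _ hpos,
      InnerProductGeometry.angle_smul_left_of_pos _ _ hpos, key]

theorem dist_mul_sin_eq_dist_mul_sin_of_angle_eq {X Y Z L : P} (h : ¬Collinear ℝ {X, Y, Z})
    (hL : Sbtw ℝ Y L Z) (hX : ∠ Y X L = ∠ L X Z) :
    dist X Y * Real.sin (∠ X Y Z) = dist X L * Real.sin (∠ Y X Z / 2 + ∠ X Y Z) := by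
  have hXY : X ≠ Y := ne₁₂_of_not_collinear h
  have hadd : ∠ Y X L + ∠ L X Z = ∠ Y X Z :=
    angle_add_of_ne_of_ne hXY (ne₁₃_of_not_collinear h) hL.wbtw
  have hY : ∠ X Y L = ∠ X Y Z := hL.angle_eq_right X
  have hsum : ∠ X Y L + ∠ Y L X + ∠ L X Y = Real.pi :=
    angle_add_angle_add_angle_eq_pi L hXY.symm
  have hsupp : ∠ Y X Z / 2 + ∠ X Y Z = Real.pi - ∠ Y L X := by
    rw [angle_comm L X Y] at hsum
    linarith
  have hsin := law_sin L Y X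
  rw [angle_comm L Y X, angle_comm X L Y, dist_comm Y X] at hsin
  rw [hsupp, Real.sin_pi_sub, ← hY]
  linarith

theorem sin_half_angle_add_angle_pos {X Y Z : P} (h : ¬Collinear ℝ {X, Y, Z}) :
    0 < Real.sin (∠ Y X Z / 2 + ∠ X Y Z) := by
  have hX : 0 < ∠ Y X Z := angle_pos_of_not_collinear (by rwa [insert_comm])
  have hY : 0 < ∠ X Y Z := angle_pos_of_not_collinear h
  have hsum := angle_add_angle_add_angle_eq_pi Z (ne₁₂_of_not_collinear h).symm
  rw [angle_comm Z X Y] at hsum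
  exact Real.sin_pos_of_pos_of_lt_pi (by linarith) (by linarith [angle_nonneg Y Z X])

end Bisector

theorem bisectorHasLength_iff {X Y Z : EuclideanSpace ℝ (Fin 2)} (h : ¬Collinear ℝ {X, Y, Z})
    (l : ℝ) : BisectorHasLength X Y Z l ↔
      dist X Y * Real.sin (∠ X Y Z) = l * Real.sin (∠ Y X Z / 2 + ∠ X Y Z) := by
  constructor
  · rintro ⟨L, hL, hX, rfl⟩
    exact dist_mul_sin_eq_dist_mul_sin_of_angle_eq h hL hX
  · intro hl
    obtain ⟨L, hL, hX⟩ := exists_sbtw_angle_eq_angle h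
    have hl' := dist_mul_sin_eq_dist_mul_sin_of_angle_eq h hL hX
    exact ⟨L, hL, hX, mul_right_cancel₀ (sin_half_angle_add_angle_pos h).ne' (hl'.symm.trans hl)⟩

theorem BisectorHasLength.symm {X Y Z : EuclideanSpace ℝ (Fin 2)} {l : ℝ}
    (h : BisectorHasLength X Y Z l) : BisectorHasLength X Z Y l := by
  obtain ⟨L, hL, hX, hl⟩ := h
  refine ⟨L, hL.symm, ?_, hl⟩
  rw [angle_comm Z X L, ← hX, angle_comm Y X L]

theorem BisectorHasLength.inv_dist_add_inv_dist {X Y Z : EuclideanSpace ℝ (Fin 2)} {l : ℝ}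
    (h : BisectorHasLength X Y Z l) (hXYZ : ¬Collinear ℝ {X, Y, Z}) :
    (dist X Y)⁻¹ + (dist X Z)⁻¹ = 2 * Real.cos (∠ Y X Z / 2) / l := by
  have hXZY : ¬Collinear ℝ {X, Z, Y} := by rwa [pair_comm]
  have hXY : 0 < dist X Y := dist_pos.2 (ne₁₂_of_not_collinear hXYZ)
  have hXZ : 0 < dist X Z := dist_pos.2 (ne₁₃_of_not_collinear hXYZ)
  have hS := sin_half_angle_add_angle_pos hXYZ
  have hsum := angle_add_angle_add_angle_eq_pi Z (ne₁₂_of_not_collinear hXYZ).symm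
  have hY := (bisectorHasLength_iff hXYZ l).1 h
  have hZ := (bisectorHasLength_iff hXZY l).1 h.symm
  rw [angle_comm Y Z X, angle_comm Z X Y] at hsum
  rw [angle_comm Z X Y, show ∠ Y X Z / 2 + ∠ X Z Y = Real.pi - (∠ Y X Z / 2 + ∠ X Y Z) by linarith,
    Real.sin_pi_sub] at hZ
  have hl : l ≠ 0 := by
    rintro rfl
    have hsinY := Real.sin_pos_of_pos_of_lt_pi (angle_pos_of_not_collinear hXYZ)
      (angle_lt_pi_of_not_collinear hXYZ)
    rw [zero_mul] at hY
    exact (mul_pos hXY hsinY).ne' hY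
  have hsin : Real.sin (∠ X Y Z) + Real.sin (∠ X Z Y) =
      2 * Real.cos (∠ Y X Z / 2) * Real.sin (∠ Y X Z / 2 + ∠ X Y Z) := by
    rw [show ∠ X Z Y = Real.pi - (∠ Y X Z + ∠ X Y Z) by linarith, Real.sin_pi_sub, mul_right_comm,
      Real.two_mul_sin_mul_cos]
    ring_nf
  rw [eq_div_iff hl]
  refine mul_right_cancel₀ hS.ne' ?_
  rw [mul_assoc, ← hsin, add_mul]
  nth_rewrite 1 [← hY]
  rw [← hZ, inv_mul_cancel_left₀ hXY.ne', inv_mul_cancel_left₀ hXZ.ne']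

section Triangle

/-- The vector of the plane with polar coordinates `(r, θ)`. -/
noncomputable def polar (r θ : ℝ) : EuclideanSpace ℝ (Fin 2) := !₂[r * Real.cos θ, r * Real.sin θ]

theorem inner_polar_polar (r r' θ θ' : ℝ) :
    inner ℝ (polar r θ) (polar r' θ') = r * r' * Real.cos (θ - θ') := by
  rw [Real.cos_sub, PiLp.inner_apply, Fin.sum_univ_two]
  simp only [polar, PiLp.toLp_apply, RCLike.inner_apply, Matrix.cons_val_zero, Matrix.cons_val_one,
    conj_trivial]
  ring

theorem norm_polar {r : ℝ} (hr : 0 ≤ r) (θ : ℝ) : ‖polar r θ‖ = r := by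
  rw [norm_eq_sqrt_real_inner, inner_polar_polar, sub_self, Real.cos_zero, mul_one,
    Real.sqrt_mul_self hr]

theorem angle_polar_polar {r r' θ θ' : ℝ} (hr : 0 < r) (hr' : 0 < r') (h₀ : 0 ≤ θ - θ')
    (hπ : θ - θ' ≤ Real.pi) :
    InnerProductGeometry.angle (polar r θ) (polar r' θ') = θ - θ' := by
  rw [InnerProductGeometry.angle, norm_polar hr.le, norm_polar hr'.le, inner_polar_polar,
    mul_div_cancel_left₀ _ (mul_pos hr hr').ne', Real.arccos_cos h₀ hπ]

theorem not_collinear_points (T : Tri) :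
    ¬Collinear ℝ {T.points 0, T.points 1, T.points 2} := by
  have h : ![T.points 0, T.points 1, T.points 2] = T.points := FinVec.etaExpand_eq T.points
  rw [← affineIndependent_iff_not_collinear_set, h]
  exact T.independent

theorem not_collinear_points_swap (T : Tri) :
    ¬Collinear ℝ {T.points 1, T.points 0, T.points 2} := by
  rw [insert_comm]
  exact not_collinear_points T

theorem angleA_pos (T : Tri) : 0 < angleA T :=
  angle_pos_of_not_collinear (not_collinear_points_swap T)

theorem angleB_pos (T : Tri) : 0 < angleB T :=
  angle_pos_of_not_collinear (not_collinear_points T)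

theorem angleC_pos (T : Tri) : 0 < angleC T := by
  apply angle_pos_of_not_collinear
  rw [pair_comm]
  exact not_collinear_points T

theorem angleA_add_angleB_add_angleC (T : Tri) :
    angleA T + angleB T + angleC T = Real.pi := by
  have h := angle_add_angle_add_angle_eq_pi (T.points 2)
    (ne₁₂_of_not_collinear (not_collinear_points T)).symm
  rw [angle_comm (T.points 2), angle_comm (T.points 1) (T.points 2)] at h
  unfold angleA angleB angleC
  linarith

theorem hasBisectors_iff_mul_sin_eq (T : Tri) (l₁ l₂ : ℝ) :
    HasBisectors T l₂ l₁ ↔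
      sideC T * Real.sin (2 * (angleA T / 2)) =
          l₁ * Real.sin (2 * (angleA T / 2) + angleB T / 2) ∧
        sideC T * Real.sin (2 * (angleB T / 2)) =
          l₂ * Real.sin (2 * (angleB T / 2) + angleA T / 2) := by
  rw [HasBisectors, bisectorHasLength_iff (not_collinear_points T),
    bisectorHasLength_iff (not_collinear_points_swap T), dist_comm (T.points 1), and_comm,
    mul_div_cancel₀ _ two_ne_zero, mul_div_cancel₀ _ two_ne_zero, add_comm (angleA T),
    add_comm (angleB T)]
  rfl

theorem congruent_of_angle_side_angle {T T' : Tri} (hA : angleA T = angleA T')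
    (hc : sideC T = sideC T') (hB : angleB T = angleB T') : Congruent T.points T'.points := by
  have hcol : ¬Collinear ℝ {T.points 2, T.points 0, T.points 1} := by
    rw [insert_comm, pair_comm]
    exact not_collinear_points T
  have hA' : ∠ (T.points 2) (T.points 0) (T.points 1) =
      ∠ (T'.points 2) (T'.points 0) (T'.points 1) := by
    rw [angle_comm, angle_comm (T'.points 2)]
    exact hA
  have h := angle_side_angle hcol hA' hc hB
  rw [congruent_iff_dist_eq] at h
  refine triangle_congruent_iff_dist_eq.2 fun i j => ?_
  fin_cases i <;> fin_cases j
  exacts [h 1 1, h 1 2, h 1 0, h 2 1, h 2 2, h 2 0, h 0 1, h 0 2, h 0 0]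

-- The law of sines, for the triangle with the vertices `0`, `c` and `b * exp (i * A)`.
theorem polar_sub_polar_zero (c : ℝ) {A B : ℝ} (h : Real.sin (A + B) ≠ 0) :
    polar (c * Real.sin B / Real.sin (A + B)) A - polar c 0 =
      polar (c * Real.sin A / Real.sin (A + B)) (Real.pi - B) := by
  have hx : c * Real.sin B / Real.sin (A + B) * Real.cos A - c =
      -(c * Real.sin A / Real.sin (A + B) * Real.cos B) := by
    field_simp
    rw [Real.sin_add]
    ring
  have hy : c * Real.sin B / Real.sin (A + B) * Real.sin A =
      c * Real.sin A / Real.sin (A + B) * Real.sin B := by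
    ring
  ext i
  fin_cases i
  · simpa [polar] using hx
  · simpa [polar] using hy

theorem exists_triangle {A B c : ℝ} (hA : 0 < A) (hB : 0 < B) (hAB : A + B < Real.pi)
    (hc : 0 < c) : ∃ T : Tri, angleA T = A ∧ angleB T = B ∧ sideC T = c := by
  have hsA : 0 < Real.sin A := Real.sin_pos_of_pos_of_lt_pi hA (by linarith)
  have hsB : 0 < Real.sin B := Real.sin_pos_of_pos_of_lt_pi hB (by linarith)
  have hsC : 0 < Real.sin (A + B) := Real.sin_pos_of_pos_of_lt_pi (by linarith) hAB
  set a := c * Real.sin A / Real.sin (A + B)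
  set b := c * Real.sin B / Real.sin (A + B)
  have ha0 : 0 < a := by positivity
  have hb0 : 0 < b := by positivity
  have hYX : 0 - polar c 0 = polar c Real.pi := by
    ext i
    fin_cases i <;> simp [polar]
  have hZY : polar b A - polar c 0 = polar a (Real.pi - B) := polar_sub_polar_zero c hsC.ne'
  have hAang : ∠ (polar c 0) 0 (polar b A) = A := by
    rw [angle_comm, EuclideanGeometry.angle, vsub_eq_sub, vsub_eq_sub, sub_zero, sub_zero,
      angle_polar_polar hb0 hc, sub_zero] <;> linarith
  have hBang : ∠ 0 (polar c 0) (polar b A) = B := by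
    rw [EuclideanGeometry.angle, vsub_eq_sub, vsub_eq_sub, hYX, hZY, angle_polar_polar hc ha0,
      sub_sub_cancel] <;> linarith
  have hcol : ¬Collinear ℝ {0, polar c 0, polar b A} := by
    rw [insert_comm, collinear_iff_eq_or_eq_or_sin_eq_zero, hAang, ← norm_eq_zero,
      ← norm_eq_zero (a := polar b A), norm_polar hc.le, norm_polar hb0.le]
    exact not_or.2 ⟨hc.ne', not_or.2 ⟨hb0.ne', hsA.ne'⟩⟩
  refine ⟨⟨![0, polar c 0, polar b A], affineIndependent_iff_not_collinear_set.2 hcol⟩,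
    hAang, hBang, ?_⟩
  change dist 0 (polar c 0) = c
  rw [dist_zero_left, norm_polar hc.le]

end Triangle

section LargerRoot

/-- The larger root of the equation `(x - u) * (x - v) = w`. It exists for `0 ≤ w`, and is then
at least `u` and `v`. -/
noncomputable def largerRoot (u v w : ℝ) : ℝ := (u + v + √((u - v) ^ 2 + 4 * w)) / 2

variable {u v w x : ℝ}

theorem largerRoot_comm (u v w : ℝ) : largerRoot u v w = largerRoot v u w := by
  rw [largerRoot, largerRoot, add_comm u v, sub_sq_comm u v]

theorem largerRoot_sub_mul_largerRoot_sub (u v : ℝ) (hw : 0 ≤ w) :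
    (largerRoot u v w - u) * (largerRoot u v w - v) = w := by
  have h := Real.sq_sqrt (show 0 ≤ (u - v) ^ 2 + 4 * w by positivity)
  rw [largerRoot]
  linear_combination h / 4

theorem le_largerRoot_right (u v : ℝ) (hw : 0 ≤ w) : v ≤ largerRoot u v w := by
  have h := (abs_le.1 (Real.abs_le_sqrt (show (u - v) ^ 2 ≤ (u - v) ^ 2 + 4 * w by linarith))).1
  rw [largerRoot]
  linarith

theorem le_largerRoot_left (u v : ℝ) (hw : 0 ≤ w) : u ≤ largerRoot u v w :=
  largerRoot_comm u v w ▸ le_largerRoot_right v u hw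

theorem eq_largerRoot (hu : u ≤ x) (hv : v ≤ x) (h : (x - u) * (x - v) = w) :
    x = largerRoot u v w := by
  have hsq : (u - v) ^ 2 + 4 * w = (2 * x - u - v) ^ 2 := by rw [← h]; ring
  rw [largerRoot, hsq, Real.sqrt_sq (by linarith)]
  ring

theorem largerRoot_lt_largerRoot {u' v' w' : ℝ} (hu : u < u') (hv : v < v') (hw : w < w')
    (hw₀ : 0 ≤ w) : largerRoot u v w < largerRoot u' v' w' := by
  by_contra! hle
  have hu' := le_largerRoot_left u' v' (hw₀.trans hw.le)
  have hv' := le_largerRoot_right u' v' (hw₀.trans hw.le)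
  have h := largerRoot_sub_mul_largerRoot_sub u v hw₀
  have h' := largerRoot_sub_mul_largerRoot_sub u' v' (hw₀.trans hw.le)
  have : (largerRoot u' v' w' - u') * (largerRoot u' v' w' - v') ≤
      (largerRoot u v w - u) * (largerRoot u v w - v) :=
    mul_le_mul (by linarith) (by linarith) (by linarith) (by linarith)
  linarith

theorem cStar_eq_largerRoot (l₁ l₂ : ℝ) : cStar l₁ l₂ = largerRoot l₁ l₂ (l₁ * l₂ / 4) := by
  rw [cStar, largerRoot]
  ring_nf

theorem cStar_comm (l₁ l₂ : ℝ) : cStar l₁ l₂ = cStar l₂ l₁ := by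
  rw [cStar_eq_largerRoot, cStar_eq_largerRoot, largerRoot_comm, mul_comm l₁]

end LargerRoot

section CommonSide

/-- One of the two shifts `u`, `v` in the quadratic equation `(c - u) * (c - v) = w` for the side
`c` between the half-angles `α` and `β`; here `l` is the bisector of the angle `2 * β`. -/
noncomputable def sideOffset (l α β : ℝ) : ℝ := l * (Real.cos β - Real.tan α * Real.sin β / 2)

/-- The side between the half-angles `α` and `β` of a triangle in which the angles `2 * α` and
`2 * β` have the bisectors `l₂` and `l₁`. Unlike the simpler `l₁ * sin (2 * α + β) / sin (2 * α)`,
this expression is continuous at `α = β = 0` and decreasing in both half-angles. -/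
noncomputable def commonSide (l₁ l₂ α β : ℝ) : ℝ :=
  largerRoot (sideOffset l₁ α β) (sideOffset l₂ β α) (l₁ * l₂ * (Real.cos α * Real.cos β) / 4)

theorem commonSide_comm (l₁ l₂ α β : ℝ) : commonSide l₁ l₂ α β = commonSide l₂ l₁ β α := by
  rw [commonSide, commonSide, largerRoot_comm, mul_comm l₁, mul_comm (Real.cos α)]

theorem commonSide_zero_zero (l₁ l₂ : ℝ) : commonSide l₁ l₂ 0 0 = cStar l₁ l₂ := by
  simp [commonSide, sideOffset, cStar_eq_largerRoot]

theorem sideOffset_lt_sideOffset {l α α' β β' : ℝ} (hl : 0 < l) (hα : 0 ≤ α) (hα' : α < α')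
    (hα'' : α' < Real.pi / 2) (hβ : 0 ≤ β) (hβ' : β < β') (hβ'' : β' < Real.pi / 2) :
    sideOffset l α' β' < sideOffset l α β := by
  have hcos := Real.cos_lt_cos_of_nonneg_of_le_pi_div_two hβ hβ''.le hβ'
  have htan := Real.tan_lt_tan_of_nonneg_of_lt_pi_div_two hα hα'' hα'
  have hsin := Real.sin_lt_sin_of_lt_of_le_pi_div_two (by linarith) hβ''.le hβ'
  have htan₀ : 0 ≤ Real.tan α := Real.tan_nonneg_of_nonneg_of_le_pi_div_two hα (by linarith)
  have hsin₀ : 0 ≤ Real.sin β := Real.sin_nonneg_of_nonneg_of_le_pi hβ (by linarith)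
  have hmul : Real.tan α * Real.sin β < Real.tan α' * Real.sin β' :=
    mul_lt_mul'' htan hsin htan₀ hsin₀
  exact mul_lt_mul_of_pos_left (by linarith) hl

theorem commonSide_lt_commonSide {l₁ l₂ α α' β β' : ℝ} (hl₁ : 0 < l₁) (hl₂ : 0 < l₂) (hα : 0 ≤ α)
    (hα' : α < α') (hα'' : α' < Real.pi / 2) (hβ : 0 ≤ β) (hβ' : β < β')
    (hβ'' : β' < Real.pi / 2) : commonSide l₁ l₂ α' β' < commonSide l₁ l₂ α β := by
  have hcosα := Real.cos_lt_cos_of_nonneg_of_le_pi_div_two hα hα''.le hα'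
  have hcosβ := Real.cos_lt_cos_of_nonneg_of_le_pi_div_two hβ hβ''.le hβ'
  have hcosα' : 0 ≤ Real.cos α' := Real.cos_nonneg_of_mem_Icc ⟨by linarith, by linarith⟩
  have hcosβ' : 0 ≤ Real.cos β' := Real.cos_nonneg_of_mem_Icc ⟨by linarith, by linarith⟩
  have hmul : Real.cos α' * Real.cos β' < Real.cos α * Real.cos β :=
    mul_lt_mul'' hcosα hcosβ hcosα' hcosβ'
  refine largerRoot_lt_largerRoot (sideOffset_lt_sideOffset hl₁ hα hα' hα'' hβ hβ' hβ'')
    (sideOffset_lt_sideOffset hl₂ hβ hβ' hβ'' hα hα' hα'') ?_ (by positivity)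
  gcongr

theorem sub_sideOffset {l c α β : ℝ} (hα : 0 < α) (hα' : α < Real.pi / 2)
    (h : c * Real.sin (2 * α) = l * Real.sin (2 * α + β)) :
    c - sideOffset l α β = l * Real.cos α * Real.sin β / (2 * Real.sin α) := by
  have hsin : 0 < Real.sin α := Real.sin_pos_of_pos_of_lt_pi hα (by linarith)
  have hcos : 0 < Real.cos α := Real.cos_pos_of_mem_Ioo ⟨by linarith, hα'⟩
  rw [Real.sin_add, Real.cos_two_mul, Real.sin_two_mul] at h
  rw [sideOffset, Real.tan_eq_sin_div_cos]
  field_simp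
  linear_combination h + l * Real.sin β * Real.sin_sq_add_cos_sq α

theorem eq_commonSide {l₁ l₂ c α β : ℝ} (hl₁ : 0 < l₁) (hl₂ : 0 < l₂) (hα : 0 < α) (hβ : 0 < β)
    (hαβ : α + β ≤ Real.pi / 2) (hc₁ : c * Real.sin (2 * α) = l₁ * Real.sin (2 * α + β))
    (hc₂ : c * Real.sin (2 * β) = l₂ * Real.sin (2 * β + α)) :
    c = commonSide l₁ l₂ α β := by
  have hsinα : 0 < Real.sin α := Real.sin_pos_of_pos_of_lt_pi hα (by linarith)
  have hsinβ : 0 < Real.sin β := Real.sin_pos_of_pos_of_lt_pi hβ (by linarith)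
  have hcosα : 0 < Real.cos α := Real.cos_pos_of_mem_Ioo ⟨by linarith, by linarith⟩
  have hcosβ : 0 < Real.cos β := Real.cos_pos_of_mem_Ioo ⟨by linarith, by linarith⟩
  have h₁ := sub_sideOffset hα (by linarith) hc₁
  have h₂ := sub_sideOffset hβ (by linarith) hc₂
  refine eq_largerRoot (sub_nonneg.1 (h₁ ▸ by positivity)) (sub_nonneg.1 (h₂ ▸ by positivity)) ?_
  rw [h₁, h₂]
  field_simp
  norm_num

theorem arctan_div_add_arctan_div {x y : ℝ} (hx : 0 < x) (hy : 0 < y) :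
    Real.arctan (x / y) + Real.arctan (y / x) = Real.pi / 2 := by
  rw [← inv_div x y, Real.arctan_inv_of_pos (div_pos hx hy), add_sub_cancel]

theorem sqrt_mul_sin_arctan_div {x y : ℝ} (hx : 0 < x) (hy : 0 < y) :
    √(x ^ 2 + y ^ 2) * Real.sin (Real.arctan (x / y)) = x := by
  have h : √(1 + (x / y) ^ 2) = √(x ^ 2 + y ^ 2) / y := by
    rw [div_pow, one_add_div (by positivity), add_comm, Real.sqrt_div' _ (by positivity),
      Real.sqrt_sq hy.le]
  rw [Real.sin_arctan, h]
  field_simp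

theorem cStarStar_mul_sin_two_mul_arctan {l₁ l₂ : ℝ} (hl₁ : 0 < l₁) (hl₂ : 0 < l₂) :
    cStarStar l₁ l₂ * Real.sin (2 * Real.arctan (l₁ / l₂)) =
      l₁ * Real.sin (2 * Real.arctan (l₁ / l₂) + Real.arctan (l₂ / l₁)) := by
  rw [two_mul, add_assoc, arctan_div_add_arctan_div hl₁ hl₂, Real.sin_add_pi_div_two, ← two_mul,
    Real.sin_two_mul, cStarStar]
  linear_combination Real.cos (Real.arctan (l₁ / l₂)) * sqrt_mul_sin_arctan_div hl₁ hl₂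

theorem commonSide_arctan {l₁ l₂ : ℝ} (hl₁ : 0 < l₁) (hl₂ : 0 < l₂) :
    commonSide l₁ l₂ (Real.arctan (l₁ / l₂)) (Real.arctan (l₂ / l₁)) = cStarStar l₁ l₂ := by
  have h := cStarStar_mul_sin_two_mul_arctan hl₂ hl₁
  rw [cStarStar, add_comm (l₂ ^ 2), ← cStarStar] at h
  exact (eq_commonSide hl₁ hl₂ (Real.arctan_pos.2 (div_pos hl₁ hl₂))
    (Real.arctan_pos.2 (div_pos hl₂ hl₁)) (arctan_div_add_arctan_div hl₁ hl₂).le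
    (cStarStar_mul_sin_two_mul_arctan hl₁ hl₂) h).symm

end CommonSide

section BisectorRatio

/-- The quotient of the bisectors of the angles `2 * β` and `2 * α` in a triangle with these two
angles. -/
noncomputable def bisectorRatio (α β : ℝ) : ℝ :=
  Real.sin (2 * α) * Real.sin (2 * β + α) / (Real.sin (2 * β) * Real.sin (2 * α + β))

theorem bisectorRatio_swap (α β : ℝ) : bisectorRatio β α = (bisectorRatio α β)⁻¹ :=
  (inv_div _ _).symm

theorem sin_two_mul_pos {α : ℝ} (hα : 0 < α) (hα' : α < Real.pi / 2) : 0 < Real.sin (2 * α) :=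
  Real.sin_pos_of_pos_of_lt_pi (by linarith) (by linarith)

theorem sin_two_mul_add_pos {α β : ℝ} (hα : 0 < α) (hβ : 0 < β) (h : α + β ≤ Real.pi / 2) :
    0 < Real.sin (2 * α + β) :=
  Real.sin_pos_of_pos_of_lt_pi (by linarith) (by linarith)

theorem bisectorRatio_pos {α β : ℝ} (hα : 0 < α) (hβ : 0 < β) (h : α + β ≤ Real.pi / 2) :
    0 < bisectorRatio α β :=
  div_pos (mul_pos (sin_two_mul_pos hα (by linarith)) (sin_two_mul_add_pos hβ hα (by linarith)))
    (mul_pos (sin_two_mul_pos hβ (by linarith)) (sin_two_mul_add_pos hα hβ h))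

theorem cos_mul_cos_two_mul_add (α β : ℝ) :
    Real.cos α * Real.cos (2 * β + α) = Real.cos (α + β) ^ 2 - Real.sin β ^ 2 := by
  have h₁ : α = (α + β) - β := by ring
  have h₂ : 2 * β + α = (α + β) + β := by ring
  nth_rewrite 1 [h₁]
  rw [h₂, Real.cos_sub, Real.cos_add (α + β)]
  linear_combination Real.cos (α + β) ^ 2 * Real.sin_sq_add_cos_sq β -
    Real.sin β ^ 2 * Real.sin_sq_add_cos_sq (α + β)

theorem sin_le_sin_two_mul_add {α β : ℝ} (hα : 0 < α) (hβ : 0 < β) (h : α + β ≤ Real.pi / 2) :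
    Real.sin α ≤ Real.sin (2 * β + α) := by
  have hsin : 0 ≤ Real.sin β := Real.sin_nonneg_of_nonneg_of_le_pi hβ.le (by linarith)
  have hcos : 0 ≤ Real.cos (α + β) := Real.cos_nonneg_of_mem_Icc ⟨by linarith, h⟩
  have hsub : Real.sin (2 * β + α) - Real.sin α = 2 * Real.sin β * Real.cos (α + β) := by
    rw [Real.sin_sub_sin]
    ring_nf
  exact sub_nonneg.1 (hsub ▸ by positivity)

theorem bisectorRatio_deriv_num_pos {α β : ℝ} (hα : 0 < α) (hβ : 0 < β)
    (h : α + β ≤ Real.pi / 2) :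
    0 < 2 * Real.sin (2 * β + α) * Real.sin β +
      Real.sin (2 * α) * Real.cos (2 * β + α) * Real.sin (2 * α + β) := by
  have hsinα : 0 < Real.sin α := Real.sin_pos_of_pos_of_lt_pi hα (by linarith)
  have hsinβ : 0 < Real.sin β := Real.sin_pos_of_pos_of_lt_pi hβ (by linarith)
  have hsinβ₁ : Real.sin β < 1 := by
    rw [← Real.sin_pi_div_two]
    exact Real.sin_lt_sin_of_lt_of_le_pi_div_two (by linarith) le_rfl (by linarith)
  have hfirst : 2 * Real.sin α * Real.sin β ≤ 2 * Real.sin (2 * β + α) * Real.sin β := by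
    have := sin_le_sin_two_mul_add hα hβ h
    gcongr
  have hsecond : -(2 * Real.sin α * Real.sin β ^ 2) ≤
      Real.sin (2 * α) * Real.cos (2 * β + α) * Real.sin (2 * α + β) :=
    calc -(2 * Real.sin α * Real.sin β ^ 2)
        ≤ -(2 * Real.sin α * Real.sin β ^ 2) * Real.sin (2 * α + β) := by
          have : 0 ≤ 2 * Real.sin α * Real.sin β ^ 2 := by positivity
          have := mul_le_of_le_one_right this (Real.sin_le_one (2 * α + β))
          linarith
      _ ≤ 2 * Real.sin α * (Real.cos (α + β) ^ 2 - Real.sin β ^ 2) * Real.sin (2 * α + β) := by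
          have hcos : 0 ≤ Real.sin α * Real.cos (α + β) ^ 2 := by positivity
          refine mul_le_mul_of_nonneg_right ?_ (sin_two_mul_add_pos hα hβ h).le
          linarith
      _ = Real.sin (2 * α) * Real.cos (2 * β + α) * Real.sin (2 * α + β) := by
          rw [← cos_mul_cos_two_mul_add, Real.sin_two_mul]
          ring
  have hgap : 0 < 2 * Real.sin α * Real.sin β * (1 - Real.sin β) := by
    have := sub_pos.2 hsinβ₁
    positivity
  linarith

theorem hasDerivAt_bisectorRatio {α β : ℝ} (hα : 0 < α) (hβ : 0 < β) (h : α + β ≤ Real.pi / 2) :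
    HasDerivAt (fun α => bisectorRatio α β)
      ((2 * Real.sin (2 * β + α) * Real.sin β +
        Real.sin (2 * α) * Real.cos (2 * β + α) * Real.sin (2 * α + β)) /
        (Real.sin (2 * β) * Real.sin (2 * α + β) ^ 2)) α := by
  have hsin₁ := sin_two_mul_pos hβ (by linarith)
  have hsin₂ := sin_two_mul_add_pos hα hβ h
  have hd₁ : HasDerivAt (fun α : ℝ => Real.sin (2 * α)) (Real.cos (2 * α) * (2 * 1)) α :=
    ((hasDerivAt_id α).const_mul 2).sin
  have hd₂ : HasDerivAt (fun α : ℝ => Real.sin (2 * β + α)) (Real.cos (2 * β + α) * 1) α :=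
    ((hasDerivAt_id α).const_add (2 * β)).sin
  have hd₃ : HasDerivAt (fun α : ℝ => Real.sin (2 * α + β)) (Real.cos (2 * α + β) * (2 * 1)) α :=
    (((hasDerivAt_id α).const_mul 2).add_const β).sin
  have hsinβ : Real.sin β = Real.sin (2 * α + β) * Real.cos (2 * α) -
      Real.cos (2 * α + β) * Real.sin (2 * α) := by
    rw [← Real.sin_sub, add_sub_cancel_left]
  refine ((hd₁.mul hd₂).div (hd₃.const_mul (Real.sin (2 * β)))
    (mul_pos hsin₁ hsin₂).ne').congr_deriv ?_
  rw [hsinβ, Pi.mul_apply]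
  field_simp
  ring

theorem strictMonoOn_bisectorRatio {β : ℝ} (hβ : 0 < β) :
    StrictMonoOn (fun α => bisectorRatio α β) (Ioc 0 (Real.pi / 2 - β)) := by
  refine strictMonoOn_of_deriv_pos (convex_Ioc _ _) (fun α hα =>
    (hasDerivAt_bisectorRatio hα.1 hβ (by linarith [hα.2])).continuousAt.continuousWithinAt) ?_
  intro α hα
  rw [interior_Ioc] at hα
  have hsum : α + β ≤ Real.pi / 2 := by linarith [hα.2]
  rw [(hasDerivAt_bisectorRatio hα.1 hβ hsum).deriv]
  exact div_pos (bisectorRatio_deriv_num_pos hα.1 hβ hsum)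
    (mul_pos (sin_two_mul_pos hβ (by linarith [hα.1]))
      (pow_pos (sin_two_mul_add_pos hα.1 hβ hsum) 2))

theorem strictAntiOn_bisectorRatio {α : ℝ} (hα : 0 < α) :
    StrictAntiOn (fun β => bisectorRatio α β) (Ioc 0 (Real.pi / 2 - α)) := by
  intro β hβ β' hβ' hlt
  change bisectorRatio α β' < bisectorRatio α β
  rw [bisectorRatio_swap, bisectorRatio_swap β]
  exact inv_strictAnti₀ (bisectorRatio_pos hβ.1 hα (by linarith [hβ.2]))
    (strictMonoOn_bisectorRatio hα hβ hβ' hlt)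

theorem bisectorRatio_pi_div_two_sub {α : ℝ} (hα : 0 < α) (hα' : α < Real.pi / 2) :
    bisectorRatio α (Real.pi / 2 - α) = Real.tan α := by
  have hsin₂ := sin_two_mul_pos hα hα'
  have h₁ : 2 * (Real.pi / 2 - α) = Real.pi - 2 * α := by ring
  have h₂ : Real.pi - 2 * α + α = Real.pi - α := by ring
  have h₃ : 2 * α + (Real.pi / 2 - α) = α + Real.pi / 2 := by ring
  rw [bisectorRatio, h₁, h₂, h₃, Real.sin_pi_sub, Real.sin_pi_sub, Real.sin_add_pi_div_two,
    mul_div_mul_left _ _ hsin₂.ne', Real.tan_eq_sin_div_cos]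

end BisectorRatio

section HalfAnglePair

/-- The half-angles `α` and `β` of a triangle whose bisectors of the angles `2 * β` and `2 * α`
have the quotient `r`. The case `α + β = π / 2`, in which the third vertex is at infinity, is
included. -/
structure IsHalfAnglePair (r α β : ℝ) : Prop where
  left_pos : 0 < α
  right_pos : 0 < β
  add_le : α + β ≤ Real.pi / 2
  ratio_eq : bisectorRatio α β = r

namespace IsHalfAnglePair

variable {r α α' β β' : ℝ}

theorem symm (h : IsHalfAnglePair r α β) : IsHalfAnglePair r⁻¹ β α where
  left_pos := h.right_pos
  right_pos := h.left_pos
  add_le := by rw [add_comm]; exact h.add_le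
  ratio_eq := by rw [bisectorRatio_swap, h.ratio_eq]

theorem left_lt_pi_div_two (h : IsHalfAnglePair r α β) : α < Real.pi / 2 := by
  linarith [h.right_pos, h.add_le]

theorem right_lt_pi_div_two (h : IsHalfAnglePair r α β) : β < Real.pi / 2 :=
  h.symm.left_lt_pi_div_two

theorem right_lt_of_left_lt (h : IsHalfAnglePair r α β) (h' : IsHalfAnglePair r α' β')
    (hlt : α < α') : β < β' := by
  by_contra! hle
  have hanti : bisectorRatio α β ≤ bisectorRatio α β' :=
    (strictAntiOn_bisectorRatio h.left_pos).antitoneOn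
      ⟨h'.right_pos, by linarith [h.add_le]⟩ ⟨h.right_pos, by linarith [h.add_le]⟩ hle
  have hmono : bisectorRatio α β' < bisectorRatio α' β' :=
    strictMonoOn_bisectorRatio h'.right_pos
      ⟨h.left_pos, by linarith [h.add_le]⟩ ⟨h'.left_pos, by linarith [h'.add_le]⟩ hlt
  rw [h.ratio_eq] at hanti
  rw [h'.ratio_eq] at hmono
  exact (hanti.trans_lt hmono).false

theorem left_lt_iff_right_lt (h : IsHalfAnglePair r α β) (h' : IsHalfAnglePair r α' β') :
    α < α' ↔ β < β' :=
  ⟨h.right_lt_of_left_lt h', h.symm.right_lt_of_left_lt h'.symm⟩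

theorem left_lt_iff_add_lt (h : IsHalfAnglePair r α β) (h' : IsHalfAnglePair r α' β') :
    α < α' ↔ α + β < α' + β' := by
  have := h.left_lt_iff_right_lt h'
  grind

theorem left_eq_of_add_eq (h : IsHalfAnglePair r α β) (h' : IsHalfAnglePair r α' β')
    (hadd : α + β = α' + β') : α = α' :=
  le_antisymm (not_lt.1 fun hlt => ((h'.left_lt_iff_add_lt h).1 hlt).ne' hadd)
    (not_lt.1 fun hlt => ((h.left_lt_iff_add_lt h').1 hlt).ne hadd)

end IsHalfAnglePair

theorem isHalfAnglePair_arctan {r : ℝ} (hr : 0 < r) :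
    IsHalfAnglePair r (Real.arctan r) (Real.arctan r⁻¹) where
  left_pos := Real.arctan_pos.2 hr
  right_pos := Real.arctan_pos.2 (inv_pos.2 hr)
  add_le := by rw [Real.arctan_inv_of_pos hr, add_sub_cancel]
  ratio_eq := by
    rw [Real.arctan_inv_of_pos hr, bisectorRatio_pi_div_two_sub (Real.arctan_pos.2 hr)
      (Real.arctan_lt_pi_div_two r), Real.tan_arctan]

theorem exists_isHalfAnglePair_of_lt {r s : ℝ} (hr : 0 < r) (hs : 0 < s)
    (hs' : s < Real.pi / 2) : ∃ α, IsHalfAnglePair r α (s - α) := by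
  -- The equation `bisectorRatio α (s - α) = r` without its denominators.
  let f : ℝ → ℝ := fun α => Real.sin (2 * α) * Real.sin (2 * (s - α) + α) -
    r * (Real.sin (2 * (s - α)) * Real.sin (2 * α + (s - α)))
  have hsin : 0 < Real.sin s := Real.sin_pos_of_pos_of_lt_pi hs (by linarith)
  have hsin₂ : 0 < Real.sin (2 * s) := sin_two_mul_pos hs hs'
  have hf₀ : f 0 < 0 := by
    have : 0 < r * (Real.sin (2 * s) * Real.sin s) := by positivity
    simpa [f] using this
  have hfs : 0 < f s := by
    have : 0 < Real.sin (2 * s) * Real.sin s := by positivity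
    simpa [f] using this
  obtain ⟨α, ⟨hα, hαs⟩, hf⟩ := intermediate_value_Ioo hs.le
    (show ContinuousOn f (Icc 0 s) by fun_prop) ⟨hf₀, hfs⟩
  have hβ : 0 < s - α := sub_pos.2 hαs
  have hadd : α + (s - α) ≤ Real.pi / 2 := by linarith
  refine ⟨α, hα, hβ, hadd, (div_eq_iff ?_).2 (sub_eq_zero.1 hf)⟩
  exact (mul_pos (sin_two_mul_pos hβ (by linarith)) (sin_two_mul_add_pos hα hβ hadd)).ne'

theorem exists_isHalfAnglePair {r s : ℝ} (hr : 0 < r) (hs : s ∈ Ioc 0 (Real.pi / 2)) :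
    ∃ α, IsHalfAnglePair r α (s - α) := by
  rcases hs.2.lt_or_eq with hlt | rfl
  · exact exists_isHalfAnglePair_of_lt hr hs.1 hlt
  · exact ⟨Real.arctan r, Real.arctan_inv_of_pos hr ▸ isHalfAnglePair_arctan hr⟩

theorem isHalfAnglePair_of_mul_sin_eq {l₁ l₂ c α β : ℝ} (hl₂ : 0 < l₂) (hα : 0 < α)
    (hβ : 0 < β) (hαβ : α + β ≤ Real.pi / 2)
    (hc₁ : c * Real.sin (2 * α) = l₁ * Real.sin (2 * α + β))
    (hc₂ : c * Real.sin (2 * β) = l₂ * Real.sin (2 * β + α)) : IsHalfAnglePair (l₁ / l₂) α β := by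
  have hsinβ := sin_two_mul_pos hβ (by linarith)
  have hsin := sin_two_mul_add_pos hα hβ hαβ
  refine ⟨hα, hβ, hαβ, ?_⟩
  rw [bisectorRatio, div_eq_div_iff (mul_pos hsinβ hsin).ne' hl₂.ne']
  linear_combination (-Real.sin (2 * α)) * hc₂ + Real.sin (2 * β) * hc₁

namespace IsHalfAnglePair

variable {l₁ l₂ α β : ℝ}

theorem commonSide_eq (h : IsHalfAnglePair (l₁ / l₂) α β) (hl₁ : 0 < l₁) (hl₂ : 0 < l₂) :
    commonSide l₁ l₂ α β = l₁ * Real.sin (2 * α + β) / Real.sin (2 * α) := by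
  have hsinα := sin_two_mul_pos h.left_pos h.left_lt_pi_div_two
  have hsinβ := sin_two_mul_pos h.right_pos h.right_lt_pi_div_two
  have hsin := sin_two_mul_add_pos h.left_pos h.right_pos h.add_le
  have hratio := h.ratio_eq
  rw [bisectorRatio, div_eq_div_iff (mul_pos hsinβ hsin).ne' hl₂.ne'] at hratio
  refine (eq_commonSide hl₁ hl₂ h.left_pos h.right_pos h.add_le
    (div_mul_cancel₀ _ hsinα.ne') ?_).symm
  rw [div_mul_eq_mul_div, div_eq_iff hsinα.ne']
  linarith

theorem commonSide_pos (h : IsHalfAnglePair (l₁ / l₂) α β) (hl₁ : 0 < l₁) (hl₂ : 0 < l₂) :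
    0 < commonSide l₁ l₂ α β := by
  rw [h.commonSide_eq hl₁ hl₂]
  exact div_pos (mul_pos hl₁ (sin_two_mul_add_pos h.left_pos h.right_pos h.add_le))
    (sin_two_mul_pos h.left_pos h.left_lt_pi_div_two)

theorem commonSide_mul_sin_left (h : IsHalfAnglePair (l₁ / l₂) α β) (hl₁ : 0 < l₁)
    (hl₂ : 0 < l₂) : commonSide l₁ l₂ α β * Real.sin (2 * α) = l₁ * Real.sin (2 * α + β) := by
  rw [h.commonSide_eq hl₁ hl₂,
    div_mul_cancel₀ _ (sin_two_mul_pos h.left_pos h.left_lt_pi_div_two).ne']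

theorem commonSide_mul_sin_right (h : IsHalfAnglePair (l₁ / l₂) α β) (hl₁ : 0 < l₁)
    (hl₂ : 0 < l₂) : commonSide l₁ l₂ α β * Real.sin (2 * β) = l₂ * Real.sin (2 * β + α) :=
  commonSide_comm l₁ l₂ α β ▸ (inv_div l₁ l₂ ▸ h.symm).commonSide_mul_sin_left hl₂ hl₁

end IsHalfAnglePair

theorem hasBisectors_iff_isHalfAnglePair {l₁ l₂ : ℝ} (hl₁ : 0 < l₁) (hl₂ : 0 < l₂) (T : Tri) :
    HasBisectors T l₂ l₁ ↔ IsHalfAnglePair (l₁ / l₂) (angleA T / 2) (angleB T / 2) ∧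
      sideC T = commonSide l₁ l₂ (angleA T / 2) (angleB T / 2) := by
  rw [hasBisectors_iff_mul_sin_eq]
  constructor
  · rintro ⟨h₁, h₂⟩
    have hα := half_pos (angleA_pos T)
    have hβ := half_pos (angleB_pos T)
    have hαβ : angleA T / 2 + angleB T / 2 ≤ Real.pi / 2 := by
      linarith [angleA_add_angleB_add_angleC T, angleC_pos T]
    exact ⟨isHalfAnglePair_of_mul_sin_eq hl₂ hα hβ hαβ h₁ h₂,
      eq_commonSide hl₁ hl₂ hα hβ hαβ h₁ h₂⟩
  · rintro ⟨h, hc⟩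
    rw [hc]
    exact ⟨h.commonSide_mul_sin_left hl₁ hl₂, h.commonSide_mul_sin_right hl₁ hl₂⟩

end HalfAnglePair

section HalfAngleCurve

/-- The curve `s ↦ (α s, β s)` of the pairs of half-angles with a given quotient `r` of the
bisectors, parametrized by `s = α s + β s` and extended by `(0, 0)` at `s = 0`. -/
structure IsHalfAngleCurve (r : ℝ) (α β : ℝ → ℝ) : Prop where
  left_zero : α 0 = 0
  add_eq : ∀ s, α s + β s = s
  isHalfAnglePair : ∀ s ∈ Ioc 0 (Real.pi / 2), IsHalfAnglePair r (α s) (β s)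

theorem exists_isHalfAngleCurve {r : ℝ} (hr : 0 < r) : ∃ α β, IsHalfAngleCurve r α β := by
  choose! a ha using fun s (hs : s ∈ Ioc 0 (Real.pi / 2)) => exists_isHalfAnglePair hr hs
  refine ⟨Function.update a 0 0, fun s => s - Function.update a 0 0 s, Function.update_self 0 0 a,
    fun s => add_sub_cancel _ _, fun s hs => ?_⟩
  rw [Function.update_of_ne hs.1.ne']
  exact ha s hs

namespace IsHalfAngleCurve

variable {r : ℝ} {α β : ℝ → ℝ}

theorem symm (h : IsHalfAngleCurve r α β) : IsHalfAngleCurve r⁻¹ β α where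
  left_zero := by linarith [h.left_zero, h.add_eq 0]
  add_eq s := by rw [add_comm, h.add_eq]
  isHalfAnglePair s hs := (h.isHalfAnglePair s hs).symm

theorem strictMonoOn_left (h : IsHalfAngleCurve r α β) :
    StrictMonoOn α (Icc 0 (Real.pi / 2)) := by
  intro s hs s' hs' hlt
  have hpair' := h.isHalfAnglePair s' ⟨hs.1.trans_lt hlt, hs'.2⟩
  rcases hs.1.eq_or_lt with rfl | hpos
  · rw [h.left_zero]
    exact hpair'.left_pos
  · rw [(h.isHalfAnglePair s ⟨hpos, hs.2⟩).left_lt_iff_add_lt hpair', h.add_eq, h.add_eq]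
    exact hlt

theorem left_nonneg (h : IsHalfAngleCurve r α β) {s : ℝ} (hs : s ∈ Icc 0 (Real.pi / 2)) :
    0 ≤ α s :=
  h.left_zero ▸ h.strictMonoOn_left.monotoneOn (left_mem_Icc.2 (hs.1.trans hs.2)) hs hs.1

theorem left_lt_pi_div_two (h : IsHalfAngleCurve r α β) {s : ℝ} (hs : s ∈ Icc 0 (Real.pi / 2)) :
    α s < Real.pi / 2 := by
  rcases hs.1.eq_or_lt with rfl | hpos
  · rw [h.left_zero]
    exact Real.pi_div_two_pos
  · exact (h.isHalfAnglePair s ⟨hpos, hs.2⟩).left_lt_pi_div_two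

theorem continuousOn_left (h : IsHalfAngleCurve r α β) :
    ContinuousOn α (Icc 0 (Real.pi / 2)) := by
  -- Both half-angles increase and their sum is `s`, so neither can increase faster than `s`.
  have hle : ∀ s ∈ Icc 0 (Real.pi / 2), ∀ s' ∈ Icc 0 (Real.pi / 2), s ≤ s' →
      dist (α s) (α s') ≤ dist s s' := by
    intro s hs s' hs' hss'
    have hα := h.strictMonoOn_left.monotoneOn hs hs' hss'
    have hβ := h.symm.strictMonoOn_left.monotoneOn hs hs' hss'
    rw [dist_comm, dist_comm s, Real.dist_eq, Real.dist_eq, abs_of_nonneg (sub_nonneg.2 hα),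
      abs_of_nonneg (sub_nonneg.2 hss')]
    linarith [h.add_eq s, h.add_eq s']
  refine (LipschitzOnWith.mk_one fun s hs s' hs' => ?_).continuousOn
  rcases le_total s s' with hss' | hss'
  · exact hle s hs s' hs' hss'
  · rw [dist_comm, dist_comm s]
    exact hle s' hs' s hs hss'

theorem left_pi_div_two (h : IsHalfAngleCurve r α β) (hr : 0 < r) :
    α (Real.pi / 2) = Real.arctan r := by
  refine (h.isHalfAnglePair _ (right_mem_Ioc.2 Real.pi_div_two_pos)).left_eq_of_add_eq
    (isHalfAnglePair_arctan hr) ?_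
  rw [h.add_eq, Real.arctan_inv_of_pos hr, add_sub_cancel]

end IsHalfAngleCurve

end HalfAngleCurve

section SideAlongCurve

/-- The inverse of the side opposite to the half-angle `α` in a triangle with half-angles `α` and
`β`, where `l₂` and `l₁` are the bisectors of the angles `2 * α` and `2 * β`. The inverse is used
because it is `0`, whereas the side is infinite, if `α + β = π / 2`. -/
noncomputable def invOppositeSide (l₁ l₂ α β : ℝ) : ℝ :=
  2 * Real.cos β / l₁ - (commonSide l₁ l₂ α β)⁻¹

theorem cStar_pos {l₁ l₂ : ℝ} (hl₁ : 0 < l₁) (hl₂ : 0 < l₂) : 0 < cStar l₁ l₂ := by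
  unfold cStar
  positivity

theorem invOppositeSide_zero_zero {l₁ l₂ : ℝ} (hl₁ : 0 < l₁) (hl₂ : 0 < l₂) :
    invOppositeSide l₁ l₂ 0 0 = (aStar l₁ l₂)⁻¹ := by
  have hc := cStar_pos hl₁ hl₂
  rw [invOppositeSide, commonSide_zero_zero, Real.cos_zero, aStar, inv_div]
  field_simp

theorem invOppositeSide_arctan {l₁ l₂ : ℝ} (hl₁ : 0 < l₁) (hl₂ : 0 < l₂) :
    invOppositeSide l₁ l₂ (Real.arctan (l₁ / l₂)) (Real.arctan (l₂ / l₁)) = 0 := by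
  have hsin := sqrt_mul_sin_arctan_div hl₁ hl₂
  rw [← Real.cos_pi_div_two_sub, ← arctan_div_add_arctan_div hl₁ hl₂, add_sub_cancel_left] at hsin
  rw [invOppositeSide, commonSide_arctan hl₁ hl₂, cStarStar]
  field_simp
  linarith

namespace IsHalfAngleCurve

variable {l₁ l₂ : ℝ} {α β : ℝ → ℝ}

theorem symm_div (h : IsHalfAngleCurve (l₁ / l₂) α β) : IsHalfAngleCurve (l₂ / l₁) β α :=
  inv_div l₁ l₂ ▸ h.symm

theorem continuousOn_sideOffset (h : IsHalfAngleCurve (l₁ / l₂) α β) (l : ℝ) :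
    ContinuousOn (fun s => sideOffset l (α s) (β s)) (Icc 0 (Real.pi / 2)) := by
  have hα := h.continuousOn_left
  have hβ := h.symm.continuousOn_left
  have htan : ContinuousOn (fun s => Real.tan (α s)) (Icc 0 (Real.pi / 2)) :=
    Real.continuousOn_tan_Ioo.comp hα fun s hs =>
      ⟨by linarith [h.left_nonneg hs, Real.pi_pos], h.left_lt_pi_div_two hs⟩
  unfold sideOffset
  fun_prop

theorem continuousOn_commonSide (h : IsHalfAngleCurve (l₁ / l₂) α β) :
    ContinuousOn (fun s => commonSide l₁ l₂ (α s) (β s)) (Icc 0 (Real.pi / 2)) := by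
  have hα := h.continuousOn_left
  have hβ := h.symm.continuousOn_left
  have hu := h.continuousOn_sideOffset l₁
  have hv := h.symm_div.continuousOn_sideOffset l₂
  unfold commonSide largerRoot
  fun_prop

theorem strictAntiOn_commonSide (h : IsHalfAngleCurve (l₁ / l₂) α β) (hl₁ : 0 < l₁)
    (hl₂ : 0 < l₂) :
    StrictAntiOn (fun s => commonSide l₁ l₂ (α s) (β s)) (Icc 0 (Real.pi / 2)) :=
  fun _ hs _ hs' hlt => commonSide_lt_commonSide hl₁ hl₂
    (h.left_nonneg hs) (h.strictMonoOn_left hs hs' hlt) (h.left_lt_pi_div_two hs')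
    (h.symm.left_nonneg hs) (h.symm.strictMonoOn_left hs hs' hlt) (h.symm.left_lt_pi_div_two hs')

theorem commonSide_pos (h : IsHalfAngleCurve (l₁ / l₂) α β) (hl₁ : 0 < l₁) (hl₂ : 0 < l₂) {s : ℝ}
    (hs : s ∈ Icc 0 (Real.pi / 2)) : 0 < commonSide l₁ l₂ (α s) (β s) := by
  rcases hs.1.eq_or_lt with rfl | hpos
  · rw [h.left_zero, h.symm.left_zero, commonSide_zero_zero]
    exact cStar_pos hl₁ hl₂
  · exact (h.isHalfAnglePair s ⟨hpos, hs.2⟩).commonSide_pos hl₁ hl₂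

theorem continuousOn_invOppositeSide (h : IsHalfAngleCurve (l₁ / l₂) α β) (hl₁ : 0 < l₁)
    (hl₂ : 0 < l₂) :
    ContinuousOn (fun s => invOppositeSide l₁ l₂ (α s) (β s)) (Icc 0 (Real.pi / 2)) := by
  have hβ := h.symm.continuousOn_left
  have hc := h.continuousOn_commonSide.inv₀ fun s hs => (h.commonSide_pos hl₁ hl₂ hs).ne'
  exact (((Real.continuous_cos.comp_continuousOn hβ).const_mul 2).div_const l₁).sub hc

theorem strictAntiOn_invOppositeSide (h : IsHalfAngleCurve (l₁ / l₂) α β) (hl₁ : 0 < l₁)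
    (hl₂ : 0 < l₂) :
    StrictAntiOn (fun s => invOppositeSide l₁ l₂ (α s) (β s)) (Icc 0 (Real.pi / 2)) := by
  intro s hs s' hs' hlt
  have hcos : Real.cos (β s') < Real.cos (β s) :=
    Real.cos_lt_cos_of_nonneg_of_le_pi_div_two (h.symm.left_nonneg hs)
      (h.symm.left_lt_pi_div_two hs').le (h.symm.strictMonoOn_left hs hs' hlt)
  have hinv : (commonSide l₁ l₂ (α s) (β s))⁻¹ < (commonSide l₁ l₂ (α s') (β s'))⁻¹ :=
    inv_strictAnti₀ (h.commonSide_pos hl₁ hl₂ hs') (h.strictAntiOn_commonSide hl₁ hl₂ hs hs' hlt)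
  change invOppositeSide l₁ l₂ (α s') (β s') < invOppositeSide l₁ l₂ (α s) (β s)
  unfold invOppositeSide
  gcongr

end IsHalfAngleCurve

end SideAlongCurve

section ThirdElement

/-- Half the sum of the angles at `A` and `B`, which parametrizes the triangles with given bisectors
at `A` and `B`. -/
noncomputable def halfAngleSum (T : Tri) : ℝ := angleA T / 2 + angleB T / 2

theorem halfAngleSum_mem_Ioo (T : Tri) : halfAngleSum T ∈ Ioo 0 (Real.pi / 2) := by
  have hA := angleA_pos T
  have hB := angleB_pos T
  have hC := angleC_pos T
  have hsum := angleA_add_angleB_add_angleC T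
  constructor <;> unfold halfAngleSum <;> linarith

theorem inv_sideA_of_hasBisectors {T : Tri} {la lb : ℝ} (h : HasBisectors T la lb) :
    (sideA T)⁻¹ = 2 * Real.cos (angleB T / 2) / lb - (sideC T)⁻¹ := by
  have := h.2.inv_dist_add_inv_dist (not_collinear_points_swap T)
  rw [dist_comm] at this
  exact eq_sub_of_add_eq' this

theorem inv_sideB_of_hasBisectors {T : Tri} {la lb : ℝ} (h : HasBisectors T la lb) :
    (sideB T)⁻¹ = 2 * Real.cos (angleA T / 2) / la - (sideC T)⁻¹ := by
  have := h.1.inv_dist_add_inv_dist (not_collinear_points T)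
  rw [dist_comm _ (T.points 2)] at this
  exact eq_sub_of_add_eq' this

variable {l₁ l₂ : ℝ} {α β : ℝ → ℝ}

theorem IsHalfAngleCurve.eq_of_hasBisectors (h : IsHalfAngleCurve (l₁ / l₂) α β) (hl₁ : 0 < l₁)
    (hl₂ : 0 < l₂) {T : Tri} (hT : HasBisectors T l₂ l₁) :
    angleA T / 2 = α (halfAngleSum T) ∧ angleB T / 2 = β (halfAngleSum T) ∧
      sideC T = commonSide l₁ l₂ (α (halfAngleSum T)) (β (halfAngleSum T)) := by
  obtain ⟨hpair, hc⟩ := (hasBisectors_iff_isHalfAnglePair hl₁ hl₂ T).1 hT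
  have hcurve := h.isHalfAnglePair _ (Ioo_subset_Ioc_self (halfAngleSum_mem_Ioo T))
  have hadd := h.add_eq (halfAngleSum T)
  have hA : angleA T / 2 = α (halfAngleSum T) := hpair.left_eq_of_add_eq hcurve hadd.symm
  have hB : angleB T / 2 = β (halfAngleSum T) := by
    unfold halfAngleSum at hA hadd ⊢
    linarith
  exact ⟨hA, hB, hA ▸ hB ▸ hc⟩

theorem IsHalfAngleCurve.exists_hasBisectors (h : IsHalfAngleCurve (l₁ / l₂) α β) (hl₁ : 0 < l₁)
    (hl₂ : 0 < l₂) {s : ℝ} (hs : s ∈ Ioo 0 (Real.pi / 2)) :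
    ∃ T : Tri, HasBisectors T l₂ l₁ ∧ halfAngleSum T = s := by
  have hpair := h.isHalfAnglePair s (Ioo_subset_Ioc_self hs)
  have hadd := h.add_eq s
  obtain ⟨T, hA, hB, hc⟩ := exists_triangle (mul_pos two_pos hpair.left_pos)
    (mul_pos two_pos hpair.right_pos) (by linarith [hs.2]) (hpair.commonSide_pos hl₁ hl₂)
  have hA' : angleA T / 2 = α s := by linarith
  have hB' : angleB T / 2 = β s := by linarith
  refine ⟨T, (hasBisectors_iff_isHalfAnglePair hl₁ hl₂ T).2 ?_, ?_⟩
  · rw [hA', hB']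
    exact ⟨hpair, hc⟩
  · rw [halfAngleSum, hA', hB', hadd]

theorem IsHalfAngleCurve.congruent_of_halfAngleSum_eq (h : IsHalfAngleCurve (l₁ / l₂) α β)
    (hl₁ : 0 < l₁) (hl₂ : 0 < l₂) {T T' : Tri} (hT : HasBisectors T l₂ l₁)
    (hT' : HasBisectors T' l₂ l₁) (hsum : halfAngleSum T = halfAngleSum T') :
    Congruent T.points T'.points := by
  obtain ⟨hA, hB, hc⟩ := h.eq_of_hasBisectors hl₁ hl₂ hT
  obtain ⟨hA', hB', hc'⟩ := h.eq_of_hasBisectors hl₁ hl₂ hT'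
  rw [← hsum] at hA' hB' hc'
  exact congruent_of_angle_side_angle (by linarith) (hc.trans hc'.symm) (by linarith)

theorem uniqueExactlyOn_image (hl₁ : 0 < l₁) (hl₂ : 0 < l₂) {elt : Tri → ℝ} {e : ℝ → ℝ}
    (helt : ∀ T, HasBisectors T l₂ l₁ → elt T = e (halfAngleSum T))
    (he : InjOn e (Ioo 0 (Real.pi / 2))) :
    UniqueExactlyOn l₂ l₁ elt (e '' Ioo 0 (Real.pi / 2)) := by
  obtain ⟨α, β, h⟩ := exists_isHalfAngleCurve (div_pos hl₁ hl₂)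
  refine fun x => ⟨?_, ?_⟩
  · rintro ⟨s, hs, rfl⟩
    obtain ⟨T, hT, rfl⟩ := h.exists_hasBisectors hl₁ hl₂ hs
    refine ⟨T, ⟨hT, helt T hT⟩, fun T' ⟨hT', hx⟩ =>
      h.congruent_of_halfAngleSum_eq hl₁ hl₂ hT' hT (he (halfAngleSum_mem_Ioo T') hs ?_)⟩
    rw [← hx, helt T' hT']
  · rintro hx ⟨T, hT, rfl⟩
    exact hx ⟨halfAngleSum T, halfAngleSum_mem_Ioo T, (helt T hT).symm⟩

theorem uniqueExactlyOn_of_strictMonoOn (hl₁ : 0 < l₁) (hl₂ : 0 < l₂) {elt : Tri → ℝ} {e : ℝ → ℝ}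
    (helt : ∀ T, HasBisectors T l₂ l₁ → elt T = e (halfAngleSum T))
    (hcont : ContinuousOn e (Icc 0 (Real.pi / 2)))
    (hmono : StrictMonoOn e (Icc 0 (Real.pi / 2))) :
    UniqueExactlyOn l₂ l₁ elt (Ioo (e 0) (e (Real.pi / 2))) :=
  hcont.image_Ioo_of_strictMonoOn Real.pi_div_two_pos.le hmono ▸
    uniqueExactlyOn_image hl₁ hl₂ helt (hmono.injOn.mono Ioo_subset_Icc_self)

theorem uniqueExactlyOn_of_strictAntiOn (hl₁ : 0 < l₁) (hl₂ : 0 < l₂) {elt : Tri → ℝ} {e : ℝ → ℝ}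
    (helt : ∀ T, HasBisectors T l₂ l₁ → elt T = e (halfAngleSum T))
    (hcont : ContinuousOn e (Icc 0 (Real.pi / 2)))
    (hanti : StrictAntiOn e (Icc 0 (Real.pi / 2))) :
    UniqueExactlyOn l₂ l₁ elt (Ioo (e (Real.pi / 2)) (e 0)) :=
  hcont.image_Ioo_of_strictAntiOn Real.pi_div_two_pos.le hanti ▸
    uniqueExactlyOn_image hl₁ hl₂ helt (hanti.injOn.mono Ioo_subset_Icc_self)

theorem uniqueExactlyOn_Ioi_of_inv {la lb x : ℝ} {elt : Tri → ℝ} (hx : 0 < x)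
    (h : UniqueExactlyOn la lb (fun T => (elt T)⁻¹) (Ioo 0 x⁻¹)) :
    UniqueExactlyOn la lb elt (Ioi x) := by
  intro y
  have hmem : y ∈ Ioi x ↔ y⁻¹ ∈ Ioo 0 x⁻¹ := by
    rw [← Set.mem_inv, Set.inv_Ioo_0_left (inv_pos.2 hx), inv_inv]
  simpa only [hmem, inv_inj] using h y⁻¹

theorem maxA_eq {l₁ l₂ : ℝ} (hl₁ : 0 < l₁) (hl₂ : 0 < l₂) :
    maxA l₁ l₂ = 2 * Real.arctan (l₁ / l₂) := by
  rw [maxA, maxB]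
  linarith [arctan_div_add_arctan_div hl₁ hl₂]

theorem aStar_pos {l₁ l₂ : ℝ} (hl₁ : 0 < l₁) (hl₂ : 0 < l₂) : 0 < aStar l₁ l₂ := by
  have hle : l₁ ≤ cStar l₁ l₂ :=
    cStar_eq_largerRoot l₁ l₂ ▸ le_largerRoot_left l₁ l₂ (by positivity)
  have hmul : 2 ≤ cStar l₁ l₂ * (2 / l₁) := by
    rw [mul_div_assoc', le_div_iff₀ hl₁]
    linarith
  exact div_pos (cStar_pos hl₁ hl₂) (by linarith)

theorem uniqueExactlyOn_angleA (hl₁ : 0 < l₁) (hl₂ : 0 < l₂) :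
    UniqueExactlyOn l₂ l₁ angleA (Ioo 0 (maxA l₁ l₂)) := by
  obtain ⟨α, β, h⟩ := exists_isHalfAngleCurve (div_pos hl₁ hl₂)
  have := uniqueExactlyOn_of_strictMonoOn hl₁ hl₂ (e := fun s => 2 * α s) (elt := angleA)
    (fun T hT => by linarith [(h.eq_of_hasBisectors hl₁ hl₂ hT).1])
    (h.continuousOn_left.const_mul 2)
    fun _ hs _ hs' hlt => mul_lt_mul_of_pos_left (h.strictMonoOn_left hs hs' hlt) two_pos
  rwa [h.left_zero, h.left_pi_div_two (div_pos hl₁ hl₂), mul_zero, ← maxA_eq hl₁ hl₂] at this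

theorem uniqueExactlyOn_angleB (hl₁ : 0 < l₁) (hl₂ : 0 < l₂) :
    UniqueExactlyOn l₂ l₁ angleB (Ioo 0 (maxB l₁ l₂)) := by
  obtain ⟨α, β, h⟩ := exists_isHalfAngleCurve (div_pos hl₁ hl₂)
  have := uniqueExactlyOn_of_strictMonoOn hl₁ hl₂ (e := fun s => 2 * β s) (elt := angleB)
    (fun T hT => by linarith [(h.eq_of_hasBisectors hl₁ hl₂ hT).2.1])
    (h.symm.continuousOn_left.const_mul 2)
    fun _ hs _ hs' hlt => mul_lt_mul_of_pos_left (h.symm.strictMonoOn_left hs hs' hlt) two_pos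
  rwa [h.symm.left_zero, h.symm_div.left_pi_div_two (div_pos hl₂ hl₁), mul_zero, ← maxB] at this

theorem uniqueExactlyOn_angleC (hl₁ : 0 < l₁) (hl₂ : 0 < l₂) :
    UniqueExactlyOn l₂ l₁ angleC (Ioo 0 Real.pi) := by
  have hanti : StrictAnti fun s : ℝ => Real.pi - 2 * s := fun s s' hlt => by dsimp only; linarith
  have := uniqueExactlyOn_of_strictAntiOn hl₁ hl₂ (elt := angleC)
    (fun T _ => by
      unfold halfAngleSum
      linarith [angleA_add_angleB_add_angleC T])
    (by fun_prop) (hanti.strictAntiOn _)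
  rwa [mul_zero, sub_zero, mul_div_cancel₀ _ two_ne_zero, sub_self] at this

theorem uniqueExactlyOn_sideA (hl₁ : 0 < l₁) (hl₂ : 0 < l₂) :
    UniqueExactlyOn l₂ l₁ sideA (Ioi (aStar l₁ l₂)) := by
  obtain ⟨α, β, h⟩ := exists_isHalfAngleCurve (div_pos hl₁ hl₂)
  refine uniqueExactlyOn_Ioi_of_inv (aStar_pos hl₁ hl₂) ?_
  have := uniqueExactlyOn_of_strictAntiOn hl₁ hl₂ (elt := fun T => (sideA T)⁻¹) ?_
    (h.continuousOn_invOppositeSide hl₁ hl₂) (h.strictAntiOn_invOppositeSide hl₁ hl₂)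
  · rwa [h.left_zero, h.symm.left_zero, h.left_pi_div_two (div_pos hl₁ hl₂),
      h.symm_div.left_pi_div_two (div_pos hl₂ hl₁), invOppositeSide_zero_zero hl₁ hl₂,
      invOppositeSide_arctan hl₁ hl₂] at this
  · intro T hT
    obtain ⟨-, hB, hc⟩ := h.eq_of_hasBisectors hl₁ hl₂ hT
    rw [inv_sideA_of_hasBisectors hT, hB, hc, invOppositeSide]

theorem bStar_eq_aStar (l₁ l₂ : ℝ) : bStar l₁ l₂ = aStar l₂ l₁ := by
  rw [bStar, aStar, cStar_comm]

theorem uniqueExactlyOn_sideB (hl₁ : 0 < l₁) (hl₂ : 0 < l₂) :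
    UniqueExactlyOn l₂ l₁ sideB (Ioi (bStar l₁ l₂)) := by
  obtain ⟨α, β, h⟩ := exists_isHalfAngleCurve (div_pos hl₁ hl₂)
  rw [bStar_eq_aStar]
  refine uniqueExactlyOn_Ioi_of_inv (aStar_pos hl₂ hl₁) ?_
  have := uniqueExactlyOn_of_strictAntiOn hl₁ hl₂ (elt := fun T => (sideB T)⁻¹) ?_
    (h.symm_div.continuousOn_invOppositeSide hl₂ hl₁)
    (h.symm_div.strictAntiOn_invOppositeSide hl₂ hl₁)
  · rwa [h.left_zero, h.symm.left_zero, h.left_pi_div_two (div_pos hl₁ hl₂),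
      h.symm_div.left_pi_div_two (div_pos hl₂ hl₁), invOppositeSide_zero_zero hl₂ hl₁,
      invOppositeSide_arctan hl₂ hl₁] at this
  · intro T hT
    obtain ⟨hA, -, hc⟩ := h.eq_of_hasBisectors hl₁ hl₂ hT
    rw [inv_sideB_of_hasBisectors hT, hA, hc, commonSide_comm, invOppositeSide]

theorem uniqueExactlyOn_sideC (hl₁ : 0 < l₁) (hl₂ : 0 < l₂) :
    UniqueExactlyOn l₂ l₁ sideC (Ioo (cStarStar l₁ l₂) (cStar l₁ l₂)) := by
  obtain ⟨α, β, h⟩ := exists_isHalfAngleCurve (div_pos hl₁ hl₂)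
  have := uniqueExactlyOn_of_strictAntiOn hl₁ hl₂ (elt := sideC)
    (fun T hT => (h.eq_of_hasBisectors hl₁ hl₂ hT).2.2) h.continuousOn_commonSide
    (h.strictAntiOn_commonSide hl₁ hl₂)
  rwa [h.left_zero, h.symm.left_zero, h.left_pi_div_two (div_pos hl₁ hl₂),
    h.symm_div.left_pi_div_two (div_pos hl₂ hl₁), commonSide_zero_zero,
    commonSide_arctan hl₁ hl₂] at this

end ThirdElement

end TwoBisectors

theorem mainTheorem2_general (l₁ l₂ : ℝ) (hl₁ : 0 < l₁) (hl₂ : 0 < l₂) :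
    TwoBisectors.UniqueExactlyOn l₂ l₁ TwoBisectors.angleA
        (Set.Ioo 0 (TwoBisectors.maxA l₁ l₂)) ∧
      TwoBisectors.UniqueExactlyOn l₂ l₁ TwoBisectors.angleB
        (Set.Ioo 0 (TwoBisectors.maxB l₁ l₂)) ∧
      TwoBisectors.UniqueExactlyOn l₂ l₁ TwoBisectors.angleC (Set.Ioo 0 Real.pi) ∧
      TwoBisectors.UniqueExactlyOn l₂ l₁ TwoBisectors.sideA
        (Set.Ioi (TwoBisectors.aStar l₁ l₂)) ∧
      TwoBisectors.UniqueExactlyOn l₂ l₁ TwoBisectors.sideB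
        (Set.Ioi (TwoBisectors.bStar l₁ l₂)) ∧
      TwoBisectors.UniqueExactlyOn l₂ l₁ TwoBisectors.sideC
        (Set.Ioo (TwoBisectors.cStarStar l₁ l₂) (TwoBisectors.cStar l₁ l₂)) :=
  open TwoBisectors in
  ⟨uniqueExactlyOn_angleA hl₁ hl₂, uniqueExactlyOn_angleB hl₁ hl₂, uniqueExactlyOn_angleC hl₁ hl₂,
    uniqueExactlyOn_sideA hl₁ hl₂, uniqueExactlyOn_sideB hl₁ hl₂, uniqueExactlyOn_sideC hl₁ hl₂⟩

theorem mainTheorem2 (l₁ l₂ : ℝ) (hl₂ : 0 < l₂) (hl : l₂ ≤ l₁) :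
    TwoBisectors.UniqueExactlyOn l₂ l₁ TwoBisectors.angleA
        (Set.Ioo 0 (TwoBisectors.maxA l₁ l₂)) ∧
      TwoBisectors.UniqueExactlyOn l₂ l₁ TwoBisectors.angleB
        (Set.Ioo 0 (TwoBisectors.maxB l₁ l₂)) ∧
      TwoBisectors.UniqueExactlyOn l₂ l₁ TwoBisectors.angleC (Set.Ioo 0 Real.pi) ∧
      TwoBisectors.UniqueExactlyOn l₂ l₁ TwoBisectors.sideA
        (Set.Ioi (TwoBisectors.aStar l₁ l₂)) ∧
      TwoBisectors.UniqueExactlyOn l₂ l₁ TwoBisectors.sideB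
        (Set.Ioi (TwoBisectors.bStar l₁ l₂)) ∧
      TwoBisectors.UniqueExactlyOn l₂ l₁ TwoBisectors.sideC
        (Set.Ioo (TwoBisectors.cStarStar l₁ l₂) (TwoBisectors.cStar l₁ l₂)) :=
  mainTheorem2_general l₁ l₂ (hl₂.trans_le hl) hl₂
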